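/- Conventions. An object of type $1$ is a function $\mathbb{N}\to\mathbb{N}$, an object of type $2$ is a total function $F:\mathbb{N}^{\mathbb{N}}\to\mathbb{N}$. Rationals are coded by natural numbers; every $x\in\mathbb{N}^{\mathbb{N}}$ represents a real number, namely the limit of the fast-converging sequence of rationals (i.e. $|q_n-q_{n+i}|<2^{-n}$ for all $n,i$) that it codes; a sequence that is not fast-converging is first replaced by the one that stays constant from the last index before it fails to be so. A functional $Y:\mathbb{N}^{\mathbb{N}}\to\mathbb{N}^{\mathbb{N}}$ that maps representations of equal reals to representations of equal reals represents a function $\mathbb{R}\to\mathbb{R}$, again written $Y$, and then the set $C_Y=\{r\in\mathbb{R} : Y(r)>0\}$. A realiser for HBC (the Heine-Borel theorem for countable coverings of closed sets) is a total functional $\beta$ which maps any $Y:\mathbb{N}^{\mathbb{N}}\to\mathbb{N}^{\mathbb{N}}$ and any two sequences $(a_n)_{n\in\mathbb{N}},(b_n)_{n\in\mathbb{N}}$ of (codes of) rationals to a number $\beta(Y,a,b)\in\mathbb{N}$, such that, whenever $Y$ represents a closed set $C_Y\subseteq[0,1]$ with $C_Y\subseteq\bigcup_{n\in\mathbb{N}}(a_n,b_n)$,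 we have $$C_Y\subseteq\bigcup_{n\le\beta(Y,a,b)}(a_n,b_n).$$ The functional $\beta$ is countably based if for all $Y,a,b$ there is a countable $X\subset\mathbb{N}^{\mathbb{N}}$ such that $\beta(Y,a,b)=\beta(Y',a,b)$ for every $Y'$ that agrees with $Y$ on $X$. It is computable in a functional $F$ of type $2$ if there is an index $e\in\mathbb{N}$ with $\{e\}(F,Y,a,b)=\beta(Y,a,b)$ for all $Y,a,b$, in the sense of Kleene's schemes S1-S9, where $Y$ is given to the computation through its code of type $2$, which maps $(n,x_0,x_1,\dots)$ to $Y(x)(n)$. Theorem. (1) No realiser $\beta$ for HBC is countably based. (2) No realiser $\beta$ for HBC is computable in a functional of type $2$: for every $F:\mathbb{N}^{\mathbb{N}}\to\mathbb{N}$ and every realiser $\beta$ for HBC, $\beta$ is not Kleene computable (S1-S9) in $F$. -/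

import Mathlib

/-! ### Kleene computability S1-S9 over the full type structure -/

namespace Kleene

/-- The pure types over the natural numbers: `Tp 0` is `ℕ` and `Tp (n + 1)` consists of all total
functions from `Tp n` to `ℕ`. -/
def Tp : ℕ → Type
  | 0 => ℕ
  | n + 1 => Tp n → ℕ

/-- An argument of a computation: an object of some pure type, together with that type. -/
abbrev Arg : Type := Σ n : ℕ, Tp n

/-- An object of type 0 as an argument. -/
def arg0 (x : ℕ) : Arg := ⟨0, x⟩

/-- An object of type 1 as an argument. -/
def arg1 (f : ℕ → ℕ) : Arg := ⟨1, f⟩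

/-- An object of type 2 as an argument. -/
def arg2 (F : (ℕ → ℕ) → ℕ) : Arg := ⟨2, F⟩

/-- The standard (effective, injective) numbering of finite sequences of natural numbers. -/
def seqNum (s : List ℕ) : ℕ := Encodable.encode s

/-- `Eval e as c` says that the Kleene computation with index `e` on the list of arguments `as`
terminates with value `c`, in symbols `{e}(as) = c`. It is the least relation closed under
Kleene's nine clauses. -/
inductive Eval : ℕ → List Arg → ℕ → Prop
  /-- S1, successor: `{e}(x, as) = x + 1`. -/
  | s1 (x : ℕ) (as : List Arg) : Eval (seqNum [1]) (arg0 x :: as) (x + 1)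
  /-- S2, constants: `{e}(as) = q`. -/
  | s2 (q : ℕ) (as : List Arg) : Eval (seqNum [2, q]) as q
  /-- S3, projection: `{e}(x, as) = x`. -/
  | s3 (x : ℕ) (as : List Arg) : Eval (seqNum [3]) (arg0 x :: as) x
  /-- S4, composition: `{e}(as) = {d}({d'}(as), as)`. -/
  | s4 (d d' : ℕ) (as : List Arg) (b c : ℕ) :
      Eval d' as b → Eval d (arg0 b :: as) c → Eval (seqNum [4, d, d']) as c
  /-- S5, primitive recursion, base: `{e}(0, as) = {d}(as)`. -/
  | s5_zero (d d' : ℕ) (as : List Arg) (c : ℕ) :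
      Eval d as c → Eval (seqNum [5, d, d']) (arg0 0 :: as) c
  /-- S5, primitive recursion, step: `{e}(x + 1, as) = {d'}(x, {e}(x, as), as)`. -/
  | s5_succ (d d' : ℕ) (x : ℕ) (as : List Arg) (b c : ℕ) :
      Eval (seqNum [5, d, d']) (arg0 x :: as) b → Eval d' (arg0 x :: arg0 b :: as) c →
      Eval (seqNum [5, d, d']) (arg0 (x + 1) :: as) c
  /-- S6, permutation of arguments: `{e}(a_0, …, a_(n-1)) = {d}(a_(p 0), …, a_(p (n-1)))`, where
  the list `p` is a permutation of `0, …, n - 1`. -/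
  | s6 (d : ℕ) (p : List ℕ) (as : List Arg) (c : ℕ) (hp : p.Perm (List.range as.length)) :
      Eval d (p.filterMap fun i => as[i]?) c → Eval (seqNum (6 :: d :: p)) as c
  /-- S7, application of an object of type 1: `{e}(f, x, as) = f x`. -/
  | s7 (f : ℕ → ℕ) (x : ℕ) (as : List Arg) :
      Eval (seqNum [7]) (arg1 f :: arg0 x :: as) (f x)
  /-- S8, application of an object `Φ` of type `k + 2`:
  `{e}(Φ, as) = Φ (fun y => {d}(y, Φ, as))`, where `y` ranges over all objects of type `k` and the
  computations `{d}(y, Φ, as)` all have to terminate. -/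
  | s8 (d k : ℕ) (Φ : Tp (k + 1) → ℕ) (as : List Arg) (f : Tp k → ℕ) :
      (∀ y : Tp k, Eval d (⟨k, y⟩ :: ⟨k + 2, Φ⟩ :: as) (f y)) →
      Eval (seqNum [8, d]) (⟨k + 2, Φ⟩ :: as) (Φ f)
  /-- S9, enumeration: `{e}(x, a_0, …, a_(n-1)) = {x}(a_0, …, a_(m-1))`, where `m ≤ n`. -/
  | s9 (m x : ℕ) (as : List Arg) (c : ℕ) (hm : m ≤ as.length) :
      Eval x (as.take m) c → Eval (seqNum [9, m]) (arg0 x :: as) c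

/-- The usual coding of a functional of type `1 → 1` as an object of pure type 2: the code sends
the sequence `n, x 0, x 1, …` to `Y x n`. -/
def pureCode (Y : (ℕ → ℕ) → (ℕ → ℕ)) : (ℕ → ℕ) → ℕ :=
  fun z => Y (fun n => z (n + 1)) (z 0)

/-- The functional `β`, which takes a functional of type `1 → 1` and two number sequences to a
number, is computable in the type two functional `F`: for some index `e`,
`{e}(F, Y, a, b) = β(Y, a, b)` for all inputs. -/
def ComputableIn (F : (ℕ → ℕ) → ℕ)
    (β : ((ℕ → ℕ) → (ℕ → ℕ)) → (ℕ → ℕ) → (ℕ → ℕ) → ℕ) : Prop :=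
  ∃ e : ℕ, ∀ (Y : (ℕ → ℕ) → (ℕ → ℕ)) (a b : ℕ → ℕ),
    Eval e [arg2 F, arg2 (pureCode Y), arg1 a, arg1 b] (β Y a b)

/-- `β` is countably based: each value `β(Y, a, b)` depends on the values of `Y` on a countable
subset of Baire space only. (The two number sequences are themselves countable data, so they may
be kept fixed.) -/
def CountablyBased (β : ((ℕ → ℕ) → (ℕ → ℕ)) → (ℕ → ℕ) → (ℕ → ℕ) → ℕ) : Prop :=
  ∀ (Y : (ℕ → ℕ) → (ℕ → ℕ)) (a b : ℕ → ℕ), ∃ X : Set (ℕ → ℕ), X.Countable ∧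
    ∀ Y' : (ℕ → ℕ) → (ℕ → ℕ), (∀ x ∈ X, Y' x = Y x) → β Y a b = β Y' a b

end Kleene

/-! ### Real numbers, functions on the reals and closed sets, as objects of finite type -/

namespace HeineBorel

/-- The rational number coded by a natural number: if `n` codes the pair `(k, l)`, it is
`(k / 2) / (l + 1)` for even `k` and `-((k + 1) / 2) / (l + 1)` for odd `k`. Every natural number
is a code and every rational number has a code. -/
def ratOf (n : ℕ) : ℚ :=
  if n.unpair.1 % 2 = 0 then ((n.unpair.1 / 2 : ℕ) : ℚ) / ((n.unpair.2 : ℚ) + 1)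
  else -((((n.unpair.1 + 1) / 2 : ℕ) : ℚ) / ((n.unpair.2 : ℚ) + 1))

/-- The initial segment up to `n` of the sequence of rationals coded by `x` is fast converging. -/
def FastUpTo (x : ℕ → ℕ) (n : ℕ) : Prop :=
  ∀ j ≤ n, ∀ i ≤ j, |ratOf (x i) - ratOf (x j)| < (1 / 2 : ℚ) ^ i

open Classical in
/-- The hat function: the sequence of rationals coded by `x`, frozen at the last place before it
fails to be fast converging. It leaves fast converging sequences unchanged and turns any other
sequence into a fast converging one. -/
noncomputable def hat (x : ℕ → ℕ) : ℕ → ℚ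
  | 0 => ratOf (x 0)
  | n + 1 => if FastUpTo x (n + 1) then ratOf (x (n + 1)) else hat x n

theorem hat_eq_of_fastUpTo {x : ℕ → ℕ} {n : ℕ} (h : FastUpTo x n) : hat x n = ratOf (x n) := by
  cases n with
  | zero => rfl
  | succ n => simp [hat, h]

theorem hat_fast (x : ℕ → ℕ) (n i : ℕ) : |hat x n - hat x (n + i)| < (1 / 2 : ℚ) ^ n := by
  induction i with
  | zero => simp
  | succ i ih =>
    by_cases h : FastUpTo x (n + i + 1)
    · have hn : FastUpTo x n := fun j hj => h j (by omega)
      rw [← add_assoc, hat_eq_of_fastUpTo hn, hat_eq_of_fastUpTo h]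
      exact h _ le_rfl _ (by omega)
    · have e : hat x (n + (i + 1)) = hat x (n + i) := by
        rw [← add_assoc]; simp [hat, h]
      rw [e]; exact ih

theorem hat_isCauSeq (x : ℕ → ℕ) : IsCauSeq abs (hat x) := by
  intro ε hε
  obtain ⟨n, hn⟩ := exists_pow_lt_of_lt_one hε (by norm_num : (1 / 2 : ℚ) < 1)
  refine ⟨n, fun j hj => ?_⟩
  obtain ⟨i, rfl⟩ := Nat.exists_eq_add_of_le hj
  rw [abs_sub_comm]
  exact (hat_fast x n i).trans hn

/-- The real number represented by an object of type 1: the limit of the associated fast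
converging sequence of rationals. -/
noncomputable def realOf (x : ℕ → ℕ) : ℝ := Real.mk ⟨hat x, hat_isCauSeq x⟩

/-- `Y` represents a function from the reals to the reals: it maps representations of equal reals
to representations of equal reals. -/
def RepresentsFunction (Y : (ℕ → ℕ) → (ℕ → ℕ)) : Prop :=
  ∀ x y : ℕ → ℕ, realOf x = realOf y → realOf (Y x) = realOf (Y y)

/-- The set of reals given by (the function represented by) `Y`: a real `r` is an element when the
function takes a positive value at `r`. -/
def toSet (Y : (ℕ → ℕ) → (ℕ → ℕ)) : Set ℝ :=
  {r | ∃ x : ℕ → ℕ, realOf x = r ∧ 0 < realOf (Y x)}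

/-- `β` is a realiser for the Heine-Borel theorem for countable coverings of closed sets: if `Y`
represents a closed set `C ⊆ [0, 1]` and `a`, `b` are sequences of rationals such that the
intervals `(a n, b n)` cover `C`, then those with `n ≤ β(Y, a, b)` already cover `C`. -/
def IsRealiserHBC (β : ((ℕ → ℕ) → (ℕ → ℕ)) → (ℕ → ℕ) → (ℕ → ℕ) → ℕ) : Prop :=
  ∀ (Y : (ℕ → ℕ) → (ℕ → ℕ)) (a b : ℕ → ℕ), RepresentsFunction Y →
    IsClosed (toSet Y) → toSet Y ⊆ Set.Icc (0 : ℝ) 1 →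
    (toSet Y ⊆ ⋃ n : ℕ, Set.Ioo (ratOf (a n) : ℝ) (ratOf (b n) : ℝ)) →
    toSet Y ⊆ ⋃ n : ℕ, ⋃ _ : n ≤ β Y a b, Set.Ioo (ratOf (a n) : ℝ) (ratOf (b n) : ℝ)

end HeineBorel

/-! ### Countable bases of Kleene computations -/

namespace Kleene

/-! For (1), feed the empty set and the intervals `(1/(n+2), 1)` to a countably based realiser, and
let `N` be its value. Some `r` in `(0, 1/(N+2))` is represented by no point of the countable base,
so the indicators of `∅` and `{r}` agree on the base and both give `N`. But `r` lies in none of the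
intervals with index at most `N`, although they all together cover it. (2) reduces to (1) through
`Eval.exists_countable_base`: with arguments of type at most 2, S8 only branches over `ℕ`, so a
terminating computation queries its arguments of type 2 at countably many points. -/

theorem seqNum_inj {s t : List ℕ} : seqNum s = seqNum t ↔ s = t :=
  Encodable.encode_inj

theorem arg0_inj {x y : ℕ} : arg0 x = arg0 y ↔ x = y :=
  ⟨fun h => eq_of_heq (Sigma.mk.inj h).2, fun h => h ▸ rfl⟩

theorem arg1_inj {f g : ℕ → ℕ} : arg1 f = arg1 g ↔ f = g :=
  ⟨fun h => eq_of_heq (Sigma.mk.inj h).2, fun h => h ▸ rfl⟩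

/-- Two arguments are equal, or they are objects of type 2 that agree on `X`. -/
inductive AgreeOn (X : Set (ℕ → ℕ)) : Arg → Arg → Prop
  | refl (a : Arg) : AgreeOn X a a
  | type2 (G G' : (ℕ → ℕ) → ℕ) (h : ∀ x ∈ X, G' x = G x) : AgreeOn X (arg2 G) (arg2 G')

theorem AgreeOn.mono {X X' : Set (ℕ → ℕ)} (h : X ⊆ X') {a a' : Arg} (H : AgreeOn X' a a') :
    AgreeOn X a a' := by
  cases H with
  | refl => exact .refl a
  | type2 G G' hG => exact .type2 G G' fun x hx => hG x (h hx)

theorem AgreeOn.eq_of_fst_ne {X : Set (ℕ → ℕ)} {a a' : Arg} (H : AgreeOn X a a') (h : a.1 ≠ 2) :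
    a' = a := by
  cases H with
  | refl => rfl
  | type2 => exact absurd rfl h

theorem AgreeOn.apply {X : Set (ℕ → ℕ)} {G : (ℕ → ℕ) → ℕ} {a : Arg} (H : AgreeOn X (arg2 G) a) :
    ∃ G' : (ℕ → ℕ) → ℕ, a = arg2 G' ∧ ∀ x ∈ X, G' x = G x := by
  generalize hb : arg2 G = b at H
  cases H with
  | refl => exact ⟨G, hb.symm, fun _ _ => rfl⟩
  | type2 G₁ G' h =>
    have : G = G₁ := eq_of_heq (Sigma.mk.inj hb).2
    exact ⟨G', rfl, this ▸ h⟩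

/-- Two lists of arguments agree entrywise on `X`. -/
abbrev ListAgreeOn (X : Set (ℕ → ℕ)) : List Arg → List Arg → Prop := List.Forall₂ (AgreeOn X)

theorem ListAgreeOn.mono {X X' : Set (ℕ → ℕ)} (h : X ⊆ X') {as as' : List Arg}
    (H : ListAgreeOn X' as as') : ListAgreeOn X as as' :=
  List.Forall₂.imp (fun _ _ => AgreeOn.mono h) H

theorem ListAgreeOn.filterMap {X : Set (ℕ → ℕ)} {as as' : List Arg}
    (H : ListAgreeOn X as as') (p : List ℕ) :
    ListAgreeOn X (p.filterMap fun i => as[i]?) (p.filterMap fun i => as'[i]?) := by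
  induction p with
  | nil => exact .nil
  | cons i p ih =>
    have hl := H.length_eq
    by_cases hi : i < as.length
    · have hi' : i < as'.length := hl ▸ hi
      simp only [List.filterMap_cons, List.getElem?_eq_getElem hi, List.getElem?_eq_getElem hi']
      exact .cons (H.get hi hi') ih
    · have hi' : ¬ i < as'.length := hl ▸ hi
      simpa [List.filterMap_cons, List.getElem?_eq_none (not_lt.1 hi),
        List.getElem?_eq_none (not_lt.1 hi')] using ih

/-- A computation on arguments of type at most 2 that terminates with value `c` depends on a
countable part of its arguments of type 2: no other value is obtained from arguments that agree
with the given ones there. -/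
theorem Eval.exists_countable_base {e : ℕ} {as : List Arg} {c : ℕ} (h : Eval e as c)
    (has : ∀ a ∈ as, a.1 ≤ 2) :
    ∃ X : Set (ℕ → ℕ), X.Countable ∧
      ∀ as' : List Arg, ListAgreeOn X as as' → ∀ c' : ℕ, Eval e as' c' → c' = c := by
  induction h with
  | s1 x as =>
    refine ⟨∅, Set.countable_empty, fun as' H c' h => ?_⟩
    obtain ⟨a, l, ha, -, rfl⟩ := List.forall₂_cons_left_iff.1 H
    obtain rfl := ha.eq_of_fst_ne (by simp [arg0])
    -- The first entry of the coded list determines the scheme, so inversion leaves only the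
    -- matching clause; the same pattern serves for every scheme.
    generalize he : seqNum [1] = e at h
    generalize hl : arg0 x :: l = l' at h
    cases h <;> simp_all [seqNum_inj, arg0_inj]
  | s2 q as =>
    refine ⟨∅, Set.countable_empty, fun as' H c' h => ?_⟩
    generalize he : seqNum [2, q] = e at h
    cases h <;> simp_all [seqNum_inj]
  | s3 x as =>
    refine ⟨∅, Set.countable_empty, fun as' H c' h => ?_⟩
    obtain ⟨a, l, ha, -, rfl⟩ := List.forall₂_cons_left_iff.1 H
    obtain rfl := ha.eq_of_fst_ne (by simp [arg0])
    generalize he : seqNum [3] = e at h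
    generalize hl : arg0 x :: l = l' at h
    cases h <;> simp_all [seqNum_inj, arg0_inj]
  | s4 d d' as b c _ _ ih₁ ih₂ =>
    obtain ⟨X₁, hX₁, h₁⟩ := ih₁ has
    obtain ⟨X₂, hX₂, h₂⟩ := ih₂ (by simpa [arg0] using has)
    refine ⟨X₁ ∪ X₂, hX₁.union hX₂, fun as' H c' h => ?_⟩
    generalize he : seqNum [4, d, d'] = e at h
    cases h <;> simp only [seqNum_inj, List.cons.injEq] at he <;> try omega
    case s4 b' hb hc =>
      obtain ⟨-, rfl, rfl, -⟩ := he
      obtain rfl := h₁ _ (H.mono Set.subset_union_left) _ hb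
      exact h₂ _ (.cons (.refl _) (H.mono Set.subset_union_right)) _ hc
  | s5_zero d d' as c _ ih =>
    obtain ⟨X, hX, h₁⟩ := ih fun a ha => has a (List.mem_cons_of_mem _ ha)
    refine ⟨X, hX, fun as' H c' h => ?_⟩
    obtain ⟨a, l, ha, Hl, rfl⟩ := List.forall₂_cons_left_iff.1 H
    obtain rfl := ha.eq_of_fst_ne (by simp [arg0])
    generalize he : seqNum [5, d, d'] = e at h
    generalize hl : arg0 0 :: l = l' at h
    cases h <;> simp only [seqNum_inj, List.cons.injEq] at he <;> try omega
    case s5_zero hc =>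
      obtain ⟨-, rfl, rfl, -⟩ := he
      obtain ⟨-, rfl⟩ := List.cons.inj hl
      exact h₁ _ Hl _ hc
    case s5_succ => simp [arg0_inj] at hl
  | s5_succ d d' x as b c _ _ ih₁ ih₂ =>
    have has' : ∀ a ∈ as, a.1 ≤ 2 := fun a ha => has a (List.mem_cons_of_mem _ ha)
    obtain ⟨X₁, hX₁, h₁⟩ := ih₁ (by simpa [arg0] using has')
    obtain ⟨X₂, hX₂, h₂⟩ := ih₂ (by simpa [arg0] using has')
    refine ⟨X₁ ∪ X₂, hX₁.union hX₂, fun as' H c' h => ?_⟩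
    obtain ⟨a, l, ha, Hl, rfl⟩ := List.forall₂_cons_left_iff.1 H
    obtain rfl := ha.eq_of_fst_ne (by simp [arg0])
    generalize he : seqNum [5, d, d'] = e at h
    generalize hl : arg0 (x + 1) :: l = l' at h
    cases h <;> simp only [seqNum_inj, List.cons.injEq] at he <;> try omega
    case s5_zero hc => simp [arg0_inj] at hl
    case s5_succ hb hc =>
      obtain ⟨-, rfl, rfl, -⟩ := he
      obtain ⟨hx, rfl⟩ := List.cons.inj hl
      obtain rfl := Nat.succ_injective (arg0_inj.1 hx)
      obtain rfl := h₁ _ (.cons (.refl _) (ListAgreeOn.mono Set.subset_union_left Hl)) _ hb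
      exact h₂ _ (.cons (.refl _) (.cons (.refl _)
        (ListAgreeOn.mono Set.subset_union_right Hl))) _ hc
  | s6 d p as c _ _ ih =>
    obtain ⟨X, hX, h₁⟩ := ih fun a ha => by
      obtain ⟨i, -, hi⟩ := List.mem_filterMap.1 ha
      exact has a (List.mem_of_getElem? hi)
    refine ⟨X, hX, fun as' H c' h => ?_⟩
    generalize he : seqNum (6 :: d :: p) = e at h
    cases h <;> simp only [seqNum_inj, List.cons.injEq] at he <;> try omega
    case s6 hc =>
      obtain ⟨-, rfl, rfl⟩ := he
      exact h₁ _ (H.filterMap p) _ hc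
  | s7 f x as =>
    refine ⟨∅, Set.countable_empty, fun as' H c' h => ?_⟩
    obtain ⟨a, l, ha, Hl, rfl⟩ := List.forall₂_cons_left_iff.1 H
    obtain ⟨a₁, l, ha₁, -, rfl⟩ := List.forall₂_cons_left_iff.1 Hl
    obtain rfl := ha.eq_of_fst_ne (by simp [arg1])
    obtain rfl := ha₁.eq_of_fst_ne (by simp [arg0])
    generalize he : seqNum [7] = e at h
    generalize hl : arg1 f :: arg0 x :: l = l' at h
    cases h <;> simp_all [seqNum_inj, arg0_inj, arg1_inj]
  | s8 d k Φ as f _ ih =>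
    -- The type bound enters here: the subcomputations are indexed by `ℕ`, so the union of their
    -- bases stays countable.
    obtain rfl : k = 0 := by
      have : k + 2 ≤ 2 := has ⟨k + 2, Φ⟩ List.mem_cons_self
      omega
    choose X hX h₁ using fun y => ih y (by simpa using has)
    have hc : Countable (Tp 0) := inferInstanceAs (Countable ℕ)
    -- The sets `X y` force the second computation to build the same query `f`; adding `f` itself
    -- forces the same answer.
    refine ⟨insert f (⋃ y, X y), (Set.countable_iUnion hX).insert f, fun as' H c' h => ?_⟩
    obtain ⟨a, l, ha, -, rfl⟩ := List.forall₂_cons_left_iff.1 H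
    obtain ⟨G, rfl, hG⟩ := AgreeOn.apply (G := Φ) ha
    generalize he : seqNum [8, d] = e at h
    generalize hl : arg2 G :: l = l' at h
    cases h <;> simp only [seqNum_inj, List.cons.injEq] at he <;> try omega
    case s8 k' Φ' as' f' hf =>
      obtain ⟨-, rfl, -⟩ := he
      obtain ⟨hΦ, rfl⟩ := List.cons.inj hl
      obtain ⟨hk, hΦ⟩ := Sigma.mk.inj hΦ
      obtain rfl : k' = 0 := by omega
      obtain rfl : G = Φ' := eq_of_heq hΦ
      have hff : f' = f := funext fun y => h₁ y _ (.cons (.refl _) (ListAgreeOn.mono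
        ((Set.subset_iUnion X y).trans (Set.subset_insert _ _)) H)) _ (hf y)
      rw [hff]
      exact hG f (Set.mem_insert _ _)
  | s9 m x as c _ _ ih =>
    obtain ⟨X, hX, h₁⟩ := ih fun a ha =>
      has a (List.mem_cons_of_mem _ (List.mem_of_mem_take ha))
    refine ⟨X, hX, fun as' H c' h => ?_⟩
    obtain ⟨a, l, ha, Hl, rfl⟩ := List.forall₂_cons_left_iff.1 H
    obtain rfl := ha.eq_of_fst_ne (by simp [arg0])
    generalize he : seqNum [9, m] = e at h
    generalize hl : arg0 x :: l = l' at h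
    cases h <;> simp only [seqNum_inj, List.cons.injEq] at he <;> try omega
    case s9 hc =>
      obtain ⟨-, rfl, -⟩ := he
      obtain ⟨hx, rfl⟩ := List.cons.inj hl
      obtain rfl := arg0_inj.1 hx
      exact h₁ _ (List.forall₂_take m Hl) _ hc

/-- A functional that is computable in an object of type 2 is countably based. -/
theorem ComputableIn.countablyBased {F : (ℕ → ℕ) → ℕ}
    {β : ((ℕ → ℕ) → (ℕ → ℕ)) → (ℕ → ℕ) → (ℕ → ℕ) → ℕ} (h : ComputableIn F β) :
    CountablyBased β := by
  intro Y a b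
  obtain ⟨e, he⟩ := h
  obtain ⟨X, hX, h⟩ := (he Y a b).exists_countable_base (by simp [arg1, arg2])
  -- A query `z` to `pureCode Y` reads `Y` at the tail of `z`. Termination on `Y'` need not be
  -- proved: it comes from `he Y'`.
  refine ⟨(fun z n => z (n + 1)) '' X, hX.image _, fun Y' hY' => ?_⟩
  refine (h _ (.cons (.refl _) (.cons (.type2 _ (pureCode Y') fun x hx => ?_)
    (.cons (.refl _) (.cons (.refl _) .nil)))) _ (he Y' a b)).symm
  exact congrFun (hY' _ (Set.mem_image_of_mem _ hx)) _

end Kleene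

/-! ### Representing reals and sets; the diagonal argument -/

namespace HeineBorel

theorem ratOf_pair_even (k l : ℕ) : ratOf (Nat.pair (2 * k) l) = (k : ℚ) / ((l : ℚ) + 1) := by
  simp [ratOf]

theorem ratOf_pair_odd (k l : ℕ) :
    ratOf (Nat.pair (2 * k + 1) l) = -(((k : ℚ) + 1) / ((l : ℚ) + 1)) := by
  have h : (2 * k + 1 + 1) / 2 = k + 1 := by omega
  simp [ratOf, Nat.add_mod, h]

theorem ratOf_surjective : Function.Surjective ratOf := by
  intro q
  have hden : ((q.den - 1 : ℕ) : ℚ) + 1 = q.den := by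
    exact_mod_cast Nat.sub_add_cancel q.pos
  have hq := q.num_div_den
  obtain ⟨k, hk | hk⟩ := q.num.eq_nat_or_neg
  · refine ⟨Nat.pair (2 * k) (q.den - 1), ?_⟩
    rw [ratOf_pair_even, hden]
    nth_rewrite 2 [← hq]
    rw [hk, Int.cast_natCast]
  -- Odd codes yield strictly negative rationals only, so zero needs an even code.
  · rcases k with _ | k
    · refine ⟨Nat.pair (2 * 0) 0, ?_⟩
      rw [ratOf_pair_even, ← hq, hk]
      simp
    · refine ⟨Nat.pair (2 * k + 1) (q.den - 1), ?_⟩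
      rw [ratOf_pair_odd, hden]
      nth_rewrite 2 [← hq]
      rw [hk]
      push_cast
      ring

theorem realOf_const (n : ℕ) : realOf (fun _ => n) = ratOf n := by
  have h : ∀ m, FastUpTo (fun _ => n) m := fun m j _ i _ => by simp
  have : hat (fun _ => n) = fun _ => ratOf n := funext fun m => hat_eq_of_fastUpTo (h m)
  rw [← Real.mk_const]
  unfold realOf
  congr 1
  exact Subtype.ext this

theorem realOf_surjective : Function.Surjective realOf := by
  intro r
  -- One-sided approximation: for `i ≤ j` both terms lie in `(r, r + 2^-i)`, so they differ by less
  -- than `2^-i`.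
  have hex : ∀ n : ℕ, ∃ m : ℕ, r < ratOf m ∧ (ratOf m : ℝ) < r + (1 / 2) ^ n := by
    intro n
    obtain ⟨q, h₁, h₂⟩ := exists_rat_btwn (lt_add_of_pos_right r (by positivity :
      (0 : ℝ) < (1 / 2) ^ n))
    obtain ⟨m, rfl⟩ := ratOf_surjective q
    exact ⟨m, h₁, h₂⟩
  choose x hx₁ hx₂ using hex
  have hfast : ∀ n, FastUpTo x n := by
    intro n j _ i hi
    have hp : (1 / 2 : ℝ) ^ j ≤ (1 / 2) ^ i :=
      pow_le_pow_of_le_one (by norm_num) (by norm_num) hi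
    have : |(ratOf (x i) : ℝ) - ratOf (x j)| < (1 / 2) ^ i := by
      rw [abs_lt]
      constructor <;> linarith [hx₁ i, hx₁ j, hx₂ i, hx₂ j]
    rw [← Rat.cast_lt (K := ℝ)]
    push_cast
    exact this
  refine ⟨x, ?_⟩
  have hhat : ∀ n, hat x n = ratOf (x n) := fun n => hat_eq_of_fastUpTo (hfast n)
  refine eq_of_forall_dist_le fun ε hε => ?_
  obtain ⟨n, hn⟩ := exists_pow_lt_of_lt_one hε (by norm_num : (1 / 2 : ℝ) < 1)
  refine Real.mk_near_of_forall_near ⟨n, fun j hj => ?_⟩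
  have hp : (1 / 2 : ℝ) ^ j ≤ (1 / 2) ^ n :=
    pow_le_pow_of_le_one (by norm_num) (by norm_num) hj
  change |((hat x j : ℚ) : ℝ) - r| ≤ ε
  rw [hhat, abs_le]
  constructor <;> linarith [hx₁ j, hx₂ j]

open Classical in
/-- The functional that represents the indicator function of the set `S` of reals. -/
noncomputable def indicatorFunctional (S : Set ℝ) (x : ℕ → ℕ) : ℕ → ℕ :=
  if realOf x ∈ S then fun _ => Nat.pair (2 * 1) 0 else fun _ => Nat.pair (2 * 0) 0

theorem representsFunction_indicatorFunctional (S : Set ℝ) :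
    RepresentsFunction (indicatorFunctional S) := by
  intro x y h
  unfold indicatorFunctional
  rw [h]

theorem toSet_indicatorFunctional (S : Set ℝ) : toSet (indicatorFunctional S) = S := by
  ext r
  constructor
  · rintro ⟨x, rfl, hx⟩
    by_contra h
    rw [indicatorFunctional, if_neg h, realOf_const, ratOf_pair_even] at hx
    simp at hx
  · intro h
    obtain ⟨x, rfl⟩ := realOf_surjective r
    refine ⟨x, rfl, ?_⟩
    rw [indicatorFunctional, if_pos h, realOf_const, ratOf_pair_even]
    simp

theorem IsRealiserHBC.not_countablyBased {β : ((ℕ → ℕ) → (ℕ → ℕ)) → (ℕ → ℕ) → (ℕ → ℕ) → ℕ}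
    (hβ : IsRealiserHBC β) : ¬ Kleene.CountablyBased β := by
  intro hcb
  set a : ℕ → ℕ := fun n => Nat.pair (2 * 1) (n + 1) with ha
  set b : ℕ → ℕ := fun _ => Nat.pair (2 * 1) 0 with hb
  have hI : ∀ n, Set.Ioo (ratOf (a n) : ℝ) (ratOf (b n) : ℝ) = Set.Ioo (1 / ((n : ℝ) + 2)) 1 := by
    intro n
    simp only [ha, hb, ratOf_pair_even]
    push_cast
    congr 1 <;> ring
  obtain ⟨X, hX, h⟩ := hcb (indicatorFunctional ∅) a b
  set N := β (indicatorFunctional ∅) a b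
  have hN : (0 : ℝ) < 1 / ((N : ℝ) + 2) := by positivity
  -- A nonempty open interval is uncountable, while `realOf '' X` is countable.
  obtain ⟨r, ⟨hr₀, hrN⟩, hrX⟩ : ∃ r ∈ Set.Ioo (0 : ℝ) (1 / ((N : ℝ) + 2)), r ∉ realOf '' X := by
    by_contra! hsub
    exact (Cardinal.Real.Ioo_countable_iff.1 ((hX.image realOf).mono hsub)).not_gt hN
  have hr₁ : r < 1 := hrN.trans_le (by
    rw [div_le_one (by positivity)]
    linarith [(Nat.cast_nonneg N : (0 : ℝ) ≤ N)])
  have hβN : N = β (indicatorFunctional {r}) a b := by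
    refine h _ fun x hx => ?_
    have : realOf x ∉ ({r} : Set ℝ) := fun hxr => hrX ⟨x, hx, hxr⟩
    simp only [indicatorFunctional, this, Set.mem_empty_iff_false, if_false]
  have hcover := hβ (indicatorFunctional {r}) a b (representsFunction_indicatorFunctional _)
  rw [toSet_indicatorFunctional, ← hβN] at hcover
  simp only [hI] at hcover
  have hmem := hcover isClosed_singleton
    (Set.singleton_subset_iff.2 ⟨hr₀.le, hr₁.le⟩)
    (Set.singleton_subset_iff.2 ?_) (Set.mem_singleton r)
  · simp only [Set.mem_iUnion] at hmem
    obtain ⟨n, hn, hrn, -⟩ := hmem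
    have hle : 1 / ((N : ℝ) + 2) ≤ 1 / ((n : ℝ) + 2) := by gcongr
    linarith
  -- The full family covers `r`, since `1/(n+2) ≤ 1/(n+1) < r` for some `n`.
  · obtain ⟨n, hn⟩ := exists_nat_one_div_lt hr₀
    refine Set.mem_iUnion.2 ⟨n, lt_of_le_of_lt ?_ hn, hr₁⟩
    gcongr
    norm_num

end HeineBorel

theorem theorem3p10 :
    (∀ β : ((ℕ → ℕ) → (ℕ → ℕ)) → (ℕ → ℕ) → (ℕ → ℕ) → ℕ,
      HeineBorel.IsRealiserHBC β → ¬ Kleene.CountablyBased β) ∧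
    (∀ (F : (ℕ → ℕ) → ℕ) (β : ((ℕ → ℕ) → (ℕ → ℕ)) → (ℕ → ℕ) → (ℕ → ℕ) → ℕ),
      HeineBorel.IsRealiserHBC β → ¬ Kleene.ComputableIn F β) :=
  ⟨fun _ hβ => hβ.not_countablyBased, fun _ _ hβ hc => hβ.not_countablyBased hc.countablyBased⟩
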